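/- For natural numbers $m,n\ge 1$, identify the vertices of the grid graph $P_m\times P_n$ with the set $V=\{(i,j) : 1\le i\le m,\ 1\le j\le n\}$, and let $d((i_1,j_1),(i_2,j_2))=|i_1-i_2|+|j_1-j_2|$ be the Manhattan distance. Let $$M(P_m\times P_n)=\max_{\sigma}\ \sum_{t=1}^{mn-1} d\bigl(\sigma^{-1}(t),\sigma^{-1}(t+1)\bigr),$$ where $\sigma$ ranges over all bijections $V\to\{1,2,\ldots,mn\}$. Assume that $m,n\geq 3$. Then: 1. If $m$ and $n$ are both even, then $M(P_m\times P_n)\in\{r,r+1\}$, where $r=\frac{mn(m+n)}{2}-3$. 2. If $m$ and $n$ are both odd, then $M(P_m\times P_n)\in\{r,r+1\}$, where $r=\frac{mn(m+n)}{2}-\frac{m+n}{2}-1$. 3. If $m$ is odd and $n$ is even, then $M(P_m\times P_n)=\frac{mn(m+n)}{2}-\frac{n}{2}-1$. Furthermore, for every $n\geq 2$, we have $M(P_2\times P_n)\in\{r,r+1\}$, where $r=(n+1)^2-4$. In particular, the values for the $n\times n$ grid conjectured by McNeil are exact up to an additive constant of $1$: for every $n\ge 2$, $M(P_n\times P_n)\in\{n^3-3,\,n^3-2\}$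 if $n$ is even, and $M(P_n\times P_n)\in\{n^3-n-1,\,n^3-n\}$ if $n$ is odd. -/

import Mathlib

/-- The Manhattan distance `|i₁ - i₂| + |j₁ - j₂|` between two vertices of the `m × n` grid, whose
vertex set is `Fin m × Fin n`. -/
def manhattanDist {m n : ℕ} (u v : Fin m × Fin n) : ℤ :=
  |((u.1 : ℕ) : ℤ) - ((v.1 : ℕ) : ℤ)| + |((u.2 : ℕ) : ℤ) - ((v.2 : ℕ) : ℤ)|

/-- The total Manhattan length of the walk induced by a bijective labeling `σ` of the `m × n` grid.
The labels `1, …, mn` are shifted to `0, …, mn - 1`; the walk visits the vertices in the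
order of their labels and has `mn - 1` steps. -/
def walkLength {m n : ℕ} (σ : Fin m × Fin n ≃ Fin (m * n)) : ℤ :=
  ∑ t : Fin (m * n - 1),
    manhattanDist (σ.symm ⟨(t : ℕ), by omega⟩) (σ.symm ⟨(t : ℕ) + 1, by omega⟩)

/-- `maxWalkLength m n` is `M(P_m × P_n)`: the maximum, over all bijective labelings of the `m × n`
grid, of the length of the induced walk. -/
def maxWalkLength (m n : ℕ) : ℤ :=
  Finset.univ.sup' ⟨finProdFinEquiv, Finset.mem_univ _⟩
    (walkLength : (Fin m × Fin n ≃ Fin (m * n)) → ℤ)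

/-! Let `centreDist` be twice the distance to the centre. By the triangle inequality through the
centre, twice the length of a step is at most the sum of the two values `centreDist`, with equality
if the step straddles the centre. Summing along a Hamiltonian walk counts every vertex twice except
the two ends, so the length is at most the total of `centreDist` minus its minimum (0, 1 or 2 by
parity): this is `maxWalkLength_le`.

Conversely, a Hamiltonian walk with only straddling steps loses nothing but its ends
(`le_maxWalkLength_of_isChain`). Alternating vertices of one quadrant with their antipodes gives
such steps, and vertices on a median link the two pairs of opposite quadrants. If both sides are
even, no vertex lies on a median; two straddling walks, one per pair, are then joined by one
imperfect step. -/

/-! ### Alternating lists. -/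

section Lists

variable {α : Type*}

/-- The list obtained from `l` by inserting after each entry its image under `f`. -/
def zigzag (f : α → α) (l : List α) : List α := l.flatMap fun a => [a, f a]

theorem zigzag_cons (f : α → α) (a : α) (l : List α) :
    zigzag f (a :: l) = a :: f a :: zigzag f l := rfl

theorem mem_zigzag {f : α → α} (hf : Function.Involutive f) {l : List α} {v : α} :
    v ∈ zigzag f l ↔ v ∈ l ∨ f v ∈ l := by
  induction l with
  | nil => simp [zigzag]
  | cons a l ih =>
    have : v = f a ↔ f v = a := by
      constructor <;> rintro rfl <;> simp [hf _]
    simp only [zigzag_cons, List.mem_cons, ih, this]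
    tauto

theorem nodup_zigzag {f : α → α} (hf : Function.Involutive f) {l : List α} (hl : l.Nodup)
    (h : ∀ a ∈ l, f a ∉ l) : (zigzag f l).Nodup := by
  induction l with
  | nil => simp [zigzag]
  | cons a l ih =>
    rw [List.nodup_cons] at hl
    have h1 := h a (by simp)
    simp only [List.mem_cons, not_or] at h1
    have h2 : ∀ b ∈ l, f b ∉ l := fun b hb hb' => h b (by simp [hb]) (by simp [hb'])
    simp only [zigzag_cons, List.nodup_cons, List.mem_cons, mem_zigzag hf, hf a, not_or]
    exact ⟨⟨fun h => h1.1 h.symm, hl.1, h1.2⟩, ⟨h1.2, hl.1⟩, ih hl.2 h2⟩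

/-- The order of `l` is irrelevant because `h2` relates every `f a` to every entry of `l`; so any
enumeration of a quadrant will do. -/
theorem isChain_zigzag_append {R : α → α → Prop} {f : α → α} {l l' : List α}
    (hl' : l'.IsChain R) (h1 : ∀ a ∈ l, R a (f a)) (h2 : ∀ a ∈ l, ∀ b ∈ l, R (f a) b)
    (h3 : ∀ a ∈ l, ∀ b ∈ l'.head?, R (f a) b) : (zigzag f l ++ l').IsChain R := by
  induction l with
  | nil => simpa [zigzag] using hl'
  | cons a l ih =>
    have ih' := ih (fun b hb => h1 b (by simp [hb]))
      (fun b hb c hc => h2 b (by simp [hb]) c (by simp [hc]))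
      (fun b hb => h3 b (by simp [hb]))
    rw [zigzag_cons, List.cons_append, List.cons_append, List.isChain_cons_cons]
    refine ⟨h1 a (by simp), ?_⟩
    rw [List.isChain_cons]
    refine ⟨fun b hb => ?_, ih'⟩
    cases l with
    | nil => exact h3 a (by simp) b (by simpa [zigzag] using hb)
    | cons c l =>
      simp only [zigzag_cons, List.cons_append, List.head?_cons, Option.mem_def,
        Option.some.injEq] at hb
      exact hb ▸ h2 a (by simp) c (by simp)

theorem mem_head?_zigzag_append {f : α → α} {l l' : List α} {v : α}
    (h : v ∈ (zigzag f l ++ l').head?) : v ∈ l ∨ v ∈ l'.head? := by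
  cases l with
  | nil => exact .inr (by simpa [zigzag] using h)
  | cons a l =>
    simp only [zigzag_cons, List.cons_append, List.head?_cons, Option.mem_def,
      Option.some.injEq] at h
    simp [h]

theorem exists_nodup_list [Fintype α] (p : α → Prop) :
    ∃ l : List α, l.Nodup ∧ ∀ v, v ∈ l ↔ p v := by
  classical
  exact ⟨(Finset.univ.filter p).toList, Finset.nodup_toList _, by simp⟩

end Lists

/-! ### Centred coordinates and distance to the centre. -/

section Grid

variable {m n : ℕ}

/-- Twice the signed distance of a vertex to the vertical median of the grid. -/
def centredFst (v : Fin m × Fin n) : ℤ := 2 * ((v.1 : ℕ) : ℤ) - (m - 1)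

/-- Twice the signed distance of a vertex to the horizontal median of the grid. -/
def centredSnd (v : Fin m × Fin n) : ℤ := 2 * ((v.2 : ℕ) : ℤ) - (n - 1)

/-- Twice the Manhattan distance of a vertex to the centre of the grid. -/
def centreDist (v : Fin m × Fin n) : ℤ := |centredFst v| + |centredSnd v|

/-- The reflection of a vertex in the centre of the grid. -/
def antipode (v : Fin m × Fin n) : Fin m × Fin n := (v.1.rev, v.2.rev)

/-- Two vertices straddle the centre if no median of the grid has both strictly on the same side. -/
def Straddles (u v : Fin m × Fin n) : Prop :=
  (centredFst u ≤ 0 ∧ 0 ≤ centredFst v ∨ 0 ≤ centredFst u ∧ centredFst v ≤ 0) ∧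
    (centredSnd u ≤ 0 ∧ 0 ≤ centredSnd v ∨ 0 ≤ centredSnd u ∧ centredSnd v ≤ 0)

theorem antipode_involutive : Function.Involutive (antipode : Fin m × Fin n → Fin m × Fin n) :=
  fun v => by simp [antipode]

@[simp] theorem centredFst_antipode (v : Fin m × Fin n) :
    centredFst (antipode v) = -centredFst v := by
  have := v.1.isLt
  simp only [centredFst, antipode, Fin.val_rev]
  omega

@[simp] theorem centredSnd_antipode (v : Fin m × Fin n) :
    centredSnd (antipode v) = -centredSnd v := by
  have := v.2.isLt
  simp only [centredSnd, antipode, Fin.val_rev]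
  omega

theorem eq_iff_centred {u v : Fin m × Fin n} :
    u = v ↔ centredFst u = centredFst v ∧ centredSnd u = centredSnd v := by
  simp only [centredFst, centredSnd, Prod.ext_iff, Fin.ext_iff]
  omega

theorem exists_centred_eq {x y : ℤ} (hx : -m < x ∧ x < m ∧ (x + m) % 2 = 1)
    (hy : -n < y ∧ y < n ∧ (y + n) % 2 = 1) :
    ∃ v : Fin m × Fin n, centredFst v = x ∧ centredSnd v = y := by
  refine ⟨(⟨((x + m - 1) / 2).toNat, by omega⟩, ⟨((y + n - 1) / 2).toNat, by omega⟩), ?_, ?_⟩ <;>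
  · simp only [centredFst, centredSnd]
    omega

theorem centredFst_mod_two (v : Fin m × Fin n) : (centredFst v + m) % 2 = 1 := by
  simp only [centredFst]
  omega

theorem centredSnd_mod_two (v : Fin m × Fin n) : (centredSnd v + n) % 2 = 1 := by
  simp only [centredSnd]
  omega

theorem centredFst_bounds (v : Fin m × Fin n) : -m < centredFst v ∧ centredFst v < m := by
  have := v.1.isLt
  simp only [centredFst]
  omega

theorem two_mul_manhattanDist (u v : Fin m × Fin n) :
    2 * manhattanDist u v =
      |centredFst u - centredFst v| + |centredSnd u - centredSnd v| := by
  have h (a b c : ℤ) : |2 * a - c - (2 * b - c)| = 2 * |a - b| := by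
    rw [show 2 * a - c - (2 * b - c) = 2 * (a - b) by ring, abs_mul]
    norm_num
  simp only [manhattanDist, centredFst, centredSnd, h]
  ring

theorem two_mul_manhattanDist_le (u v : Fin m × Fin n) :
    2 * manhattanDist u v ≤ centreDist u + centreDist v := by
  rw [two_mul_manhattanDist, centreDist, centreDist]
  linarith [abs_sub (centredFst u) (centredFst v), abs_sub (centredSnd u) (centredSnd v)]

theorem two_mul_manhattanDist_of_straddles {u v : Fin m × Fin n} (h : Straddles u v) :
    2 * manhattanDist u v = centreDist u + centreDist v := by
  rw [two_mul_manhattanDist, centreDist, centreDist]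
  unfold Straddles at h
  grind

/-! ### Walk lengths against the sum of distances to the centre. -/

/-- The length of the walk through the entries of a list of vertices. -/
def listLength : List (Fin m × Fin n) → ℤ
  | [] => 0
  | [_] => 0
  | u :: v :: l => manhattanDist u v + listLength (v :: l)

theorem listLength_append (u v : Fin m × Fin n) (l l' : List (Fin m × Fin n)) :
    listLength ((l ++ [u]) ++ v :: l') =
      listLength (l ++ [u]) + manhattanDist u v + listLength (v :: l') := by
  induction l with
  | nil => simp [listLength]
  | cons a l ih =>
    cases l with
    | nil => simp [listLength]; ring
    | cons b l =>
      simp only [List.cons_append, listLength] at ih ⊢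
      rw [ih]
      ring

theorem listLength_ofFn {N : ℕ} (f : Fin N → Fin m × Fin n) :
    listLength (List.ofFn f) =
      ∑ t : Fin (N - 1), manhattanDist (f ⟨t, by omega⟩) (f ⟨t + 1, by omega⟩) := by
  induction N with
  | zero => simp [listLength]
  | succ N ih =>
    cases N with
    | zero => simp [listLength]
    | succ N =>
      have h := ih (fun i => f i.succ)
      rw [List.ofFn_succ] at h
      rw [List.ofFn_succ, List.ofFn_succ, listLength, h]
      exact (Fin.sum_univ_succ (n := N)
        (fun t : Fin (N + 1) => manhattanDist (f ⟨t, by omega⟩) (f ⟨t + 1, by omega⟩))).symm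

theorem two_mul_listLength_le {k : ℤ} (hk : ∀ v : Fin m × Fin n, k ≤ centreDist v)
    (v : Fin m × Fin n) (l : List (Fin m × Fin n)) :
    2 * listLength (v :: l) ≤ 2 * ((v :: l).map centreDist).sum - centreDist v - k := by
  induction l generalizing v with
  | nil => simp [listLength]; linarith [hk v]
  | cons u l ih =>
    have h1 := ih u
    have h2 := two_mul_manhattanDist_le v u
    simp only [listLength, List.map_cons, List.sum_cons] at h1 ⊢
    linarith

theorem two_mul_listLength_of_isChain {u v : Fin m × Fin n} {l : List (Fin m × Fin n)}
    (h : (u :: (l ++ [v])).IsChain Straddles) :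
    2 * listLength (u :: (l ++ [v])) =
      2 * ((u :: (l ++ [v])).map centreDist).sum - centreDist u - centreDist v := by
  induction l generalizing u with
  | nil =>
    have := two_mul_manhattanDist_of_straddles (List.isChain_cons_cons.1 h).1
    simp [listLength]
    linarith
  | cons a l ih =>
    have h1 := ih (List.isChain_cons_cons.1 h).2
    have h2 := two_mul_manhattanDist_of_straddles (List.isChain_cons_cons.1 h).1
    simp only [List.cons_append, listLength, List.map_cons, List.sum_cons] at h1 ⊢
    linarith

theorem two_mul_sum_abs_centred (m : ℕ) :
    2 * ∑ i : Fin m, |2 * ((i : ℕ) : ℤ) - (m - 1)| = (m : ℤ) ^ 2 - m % 2 := by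
  induction m using Nat.twoStepInduction with
  | zero => simp
  | one => simp
  | more m ih _ =>
    -- Removing both extreme terms, each equal to `m + 1`, leaves the sum for `m`.
    rw [Fin.sum_univ_succ, Fin.sum_univ_castSucc]
    have h (i : Fin m) : |2 * (((i.castSucc.succ : Fin (m + 2)) : ℕ) : ℤ) - ((m + 2 : ℕ) - 1)| =
        |2 * ((i : ℕ) : ℤ) - (m - 1)| := by
      congr 1
      simp
      ring
    rw [Finset.sum_congr rfl fun i _ => h i, mul_add, mul_add, ih]
    have h1 : |2 * (((0 : Fin (m + 2)) : ℕ) : ℤ) - ((m + 2 : ℕ) - 1)| = m + 1 := by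
      rw [abs_of_nonpos] <;> simp <;> linarith
    have h2 : |2 * (((Fin.last m).succ : ℕ) : ℤ) - ((m + 2 : ℕ) - 1)| = m + 1 := by
      rw [abs_of_nonneg] <;> simp <;> linarith
    rw [h1, h2]
    push_cast
    rw [Int.add_emod_right]
    ring

theorem two_mul_sum_centreDist (m n : ℕ) :
    2 * ∑ v : Fin m × Fin n, centreDist v =
      n * ((m : ℤ) ^ 2 - m % 2) + m * ((n : ℤ) ^ 2 - n % 2) := by
  rw [← two_mul_sum_abs_centred, ← two_mul_sum_abs_centred, Fintype.sum_prod_type]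
  simp only [centreDist, centredFst, centredSnd, Finset.sum_add_distrib, Finset.sum_const,
    Finset.card_univ, Fintype.card_fin, nsmul_eq_mul, ← Finset.mul_sum]
  ring

theorem sum_map_eq_of_nodup {l : List (Fin m × Fin n)} (hl : l.Nodup) (hmem : ∀ v, v ∈ l) :
    (l.map centreDist).sum = ∑ v : Fin m × Fin n, centreDist v := by
  rw [← List.sum_toFinset _ hl]
  congr 1
  ext v
  simp [hmem v]

theorem listLength_le_maxWalkLength {l : List (Fin m × Fin n)} (hl : l.Nodup)
    (hmem : ∀ v, v ∈ l) : listLength l ≤ maxWalkLength m n := by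
  have hlen : l.length = m * n := by
    simpa using Fintype.card_congr (hl.getEquivOfForallMemList l hmem)
  let σ : Fin m × Fin n ≃ Fin (m * n) :=
    ((finCongr hlen.symm).trans (hl.getEquivOfForallMemList l hmem)).symm
  have h : l = List.ofFn σ.symm := by
    apply List.ext_getElem
    · simp [hlen]
    · intro i h1 h2
      simp [σ]
  have h' : listLength l = walkLength σ := by
    rw [h, listLength_ofFn]
    rfl
  rw [h']
  exact Finset.le_sup' walkLength (Finset.mem_univ σ)

theorem maxWalkLength_le {k : ℤ} (hm : 0 < m) (hn : 0 < n)
    (hk : ∀ v : Fin m × Fin n, k ≤ centreDist v) :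
    maxWalkLength m n ≤ ∑ v : Fin m × Fin n, centreDist v - k := by
  refine Finset.sup'_le _ _ fun σ _ => ?_
  have h : walkLength σ = listLength (List.ofFn σ.symm) := by
    rw [listLength_ofFn]
    rfl
  have hs := sum_map_eq_of_nodup (l := List.ofFn σ.symm)
    (List.nodup_ofFn.2 σ.symm.injective) (fun v => List.mem_ofFn.2 ⟨σ v, by simp⟩)
  have hpos := Nat.mul_pos hm hn
  rw [h, ← hs]
  cases hL : List.ofFn σ.symm with
  | nil => simp at hL; omega
  | cons v l => linarith [two_mul_listLength_le hk v l, hk v]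

theorem le_maxWalkLength_of_isChain {u v : Fin m × Fin n} {l : List (Fin m × Fin n)}
    (hl : (u :: (l ++ [v])).Nodup) (hmem : ∀ w, w ∈ u :: (l ++ [v]))
    (h : (u :: (l ++ [v])).IsChain Straddles) :
    2 * ∑ v : Fin m × Fin n, centreDist v - centreDist u - centreDist v ≤
      2 * maxWalkLength m n := by
  rw [← sum_map_eq_of_nodup hl hmem, ← two_mul_listLength_of_isChain h]
  linarith [listLength_le_maxWalkLength hl hmem]

end Grid

/-! ### Long walks, built backwards from their last vertex. -/

section Constructions

variable {m n : ℕ}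

/-- There is a self-avoiding walk all of whose steps straddle the centre, which visits precisely
the vertices with centred coordinates satisfying `P`, starts in `Q` and ends in `(x, y)`. -/
def HasStraddlingWalk (m n : ℕ) (x y : ℤ) (P Q : ℤ → ℤ → Prop) : Prop :=
  ∃ (l : List (Fin m × Fin n)) (t : Fin m × Fin n), centredFst t = x ∧ centredSnd t = y ∧
    (l ++ [t]).Nodup ∧ (l ++ [t]).IsChain Straddles ∧
    (∀ v, v ∈ l ++ [t] ↔ P (centredFst v) (centredSnd v)) ∧
    ∀ v ∈ (l ++ [t]).head?, Q (centredFst v) (centredSnd v)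

theorem hasStraddlingWalk_singleton {x y : ℤ} (hx : -m < x ∧ x < m ∧ (x + m) % 2 = 1)
    (hy : -n < y ∧ y < n ∧ (y + n) % 2 = 1) :
    HasStraddlingWalk m n x y (fun a b => a = x ∧ b = y) (fun a b => a = x ∧ b = y) := by
  obtain ⟨t, rfl, rfl⟩ := exists_centred_eq hx hy
  exact ⟨[], t, rfl, rfl, by simp, by simp, by simp [eq_iff_centred], by simp⟩

theorem HasStraddlingWalk.cons {x y : ℤ} {P Q : ℤ → ℤ → Prop}
    (h : HasStraddlingWalk m n x y P Q) {x' y' : ℤ}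
    (hx : -m < x' ∧ x' < m ∧ (x' + m) % 2 = 1) (hy : -n < y' ∧ y' < n ∧ (y' + n) % 2 = 1)
    (hP : ¬ P x' y')
    (hQ : ∀ a b, Q a b → (x' ≤ 0 ∧ 0 ≤ a ∨ 0 ≤ x' ∧ a ≤ 0) ∧ (y' ≤ 0 ∧ 0 ≤ b ∨ 0 ≤ y' ∧ b ≤ 0)) :
    HasStraddlingWalk m n x y (fun a b => a = x' ∧ b = y' ∨ P a b)
      (fun a b => a = x' ∧ b = y') := by
  obtain ⟨s, rfl, rfl⟩ := exists_centred_eq hx hy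
  obtain ⟨l, t, htx, hty, hnd, hch, hmem, hhead⟩ := h
  refine ⟨s :: l, t, htx, hty, ?_, ?_, ?_, by simp⟩
  · rw [List.cons_append, List.nodup_cons, hmem]
    exact ⟨hP, hnd⟩
  · rw [List.cons_append, List.isChain_cons]
    exact ⟨fun v hv => hQ _ _ (hhead v hv), hch⟩
  · intro v
    rw [List.cons_append, List.mem_cons, hmem, eq_iff_centred]

/-- If `u` and `v` share a closed quadrant, then `antipode u` and `v` straddle the centre; `hpQ`
says that `p` and the old start share one. The new start may still satisfy only `Q`, since `p` can
be empty on a small grid. -/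
theorem HasStraddlingWalk.zigzag {x y : ℤ} {P Q : ℤ → ℤ → Prop}
    (h : HasStraddlingWalk m n x y P Q) (p : ℤ → ℤ → Prop)
    (hp : ∀ a b, p a b → ¬ p (-a) (-b) ∧ ¬ P a b ∧ ¬ P (-a) (-b))
    (hpQ : ∀ a b c d, p a b → p c d ∨ Q c d →
      (a ≤ 0 ∧ c ≤ 0 ∨ 0 ≤ a ∧ 0 ≤ c) ∧ (b ≤ 0 ∧ d ≤ 0 ∨ 0 ≤ b ∧ 0 ≤ d)) :
    HasStraddlingWalk m n x y (fun a b => p a b ∨ p (-a) (-b) ∨ P a b)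
      (fun a b => p a b ∨ Q a b) := by
  obtain ⟨l, t, htx, hty, hnd, hch, hmem, hhead⟩ := h
  obtain ⟨X, hX, hX'⟩ := exists_nodup_list fun v : Fin m × Fin n =>
    p (centredFst v) (centredSnd v)
  have hr := antipode_involutive (m := m) (n := n)
  have hst (u v : Fin m × Fin n) (hu : p (centredFst u) (centredSnd u))
      (hv : p (centredFst v) (centredSnd v) ∨ Q (centredFst v) (centredSnd v)) :
      Straddles (antipode u) v := by
    have := hpQ _ _ _ _ hu hv
    simp only [Straddles, centredFst_antipode, centredSnd_antipode]
    omega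
  refine ⟨_root_.zigzag antipode X ++ l, t, htx, hty, ?_, ?_, ?_, ?_⟩
  · rw [List.append_assoc, List.nodup_append']
    refine ⟨nodup_zigzag hr hX fun v hv => ?_, hnd, fun v hv hv' => ?_⟩
    · rw [hX', centredFst_antipode, centredSnd_antipode]
      exact (hp _ _ ((hX' v).1 hv)).1
    · rw [hmem] at hv'
      rw [mem_zigzag hr, hX', hX', centredFst_antipode, centredSnd_antipode] at hv
      rcases hv with hv | hv
      · exact (hp _ _ hv).2.1 hv'
      · exact (hp _ _ hv).2.2 (by simpa using hv')
  · rw [List.append_assoc]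
    refine isChain_zigzag_append hch (fun u _ => ?_)
      (fun u hu v hv => hst u v ((hX' u).1 hu) (.inl ((hX' v).1 hv)))
      (fun u hu v hv => hst u v ((hX' u).1 hu) (.inr (hhead v hv)))
    simp only [Straddles, centredFst_antipode, centredSnd_antipode]
    omega
  · intro v
    rw [List.append_assoc, List.mem_append, mem_zigzag hr, hX', hX', hmem, centredFst_antipode,
      centredSnd_antipode, or_assoc]
  · intro v hv
    rw [List.append_assoc] at hv
    exact (mem_head?_zigzag_append hv).imp (hX' v).1 (hhead v)

theorem HasStraddlingWalk.exists_cons {x y x' y' : ℤ} {P : ℤ → ℤ → Prop}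
    (h : HasStraddlingWalk m n x y P (fun a b => a = x' ∧ b = y')) (hne : x' ≠ x ∨ y' ≠ y) :
    ∃ (s t : Fin m × Fin n) (l : List (Fin m × Fin n)), centredFst s = x' ∧ centredSnd s = y' ∧
      centredFst t = x ∧ centredSnd t = y ∧ (s :: (l ++ [t])).Nodup ∧
      (s :: (l ++ [t])).IsChain Straddles ∧
      ∀ v, v ∈ s :: (l ++ [t]) ↔ P (centredFst v) (centredSnd v) := by
  obtain ⟨l, t, htx, hty, hnd, hch, hmem, hhead⟩ := h
  cases l with
  | nil =>
    have := hhead t (by simp)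
    omega
  | cons s l =>
    have := hhead s (by simp)
    exact ⟨s, t, l, this.1, this.2, htx, hty, hnd, hch, hmem⟩

theorem HasStraddlingWalk.le_maxWalkLength {x y x' y' : ℤ} {P : ℤ → ℤ → Prop}
    (h : HasStraddlingWalk m n x y P (fun a b => a = x' ∧ b = y')) (hne : x' ≠ x ∨ y' ≠ y)
    (hP : ∀ v : Fin m × Fin n, P (centredFst v) (centredSnd v)) :
    2 * ∑ v : Fin m × Fin n, centreDist v - (|x'| + |y'|) - (|x| + |y|) ≤
      2 * maxWalkLength m n := by
  obtain ⟨s, t, l, rfl, rfl, rfl, rfl, hnd, hch, hmem⟩ := h.exists_cons hne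
  exact le_maxWalkLength_of_isChain hnd (fun v => (hmem v).2 (hP v)) hch

/-- The ends are the centre and `(0, 2)`, with `centreDist` 0 and 2, so the loss is half of 2. -/
theorem le_maxWalkLength_of_odd_of_odd (hm : Odd m) (hn : Odd n) (hm3 : 3 ≤ m) (hn3 : 3 ≤ n) :
    ∑ v : Fin m × Fin n, centreDist v - 1 ≤ maxWalkLength m n := by
  rw [Nat.odd_iff] at hm hn
  have h0 := hasStraddlingWalk_singleton (m := m) (n := n) (x := 0) (y := 2)
    (by omega) (by omega)
  have h1 := h0.cons (x' := 0) (y' := -2) (by omega) (by omega) (by omega) (by omega)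
  have h2 := h1.zigzag (fun a b => a = 0 ∧ b < 0 ∧ b ≠ -2) (by omega) (by omega)
  have h3 := h2.zigzag (fun a b => 0 < a ∧ b < 0) (by omega) (by omega)
  have h4 := h3.cons (x' := -2) (y' := 0) (by omega) (by omega) (by omega) (by omega)
  have h5 := h4.cons (x' := 2) (y' := 0) (by omega) (by omega) (by omega) (by omega)
  have h6 := h5.zigzag (fun a b => 0 < a ∧ b = 0 ∧ a ≠ 2) (by omega) (by omega)
  have h7 := h6.zigzag (fun a b => 0 < a ∧ 0 < b) (by omega) (by omega)
  have h8 := h7.cons (x' := 0) (y' := 0) (by omega) (by omega) (by omega) (by omega)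
  have := h8.le_maxWalkLength (by omega) (fun v => by omega)
  norm_num at this
  linarith

/-- Both ends `(0, 1)` and `(0, -1)` attain the minimal `centreDist` 1, so this meets the upper
bound. -/
theorem le_maxWalkLength_of_odd_of_even (hm : Odd m) (hn : Even n) (hm3 : 3 ≤ m) (hn3 : 3 ≤ n) :
    ∑ v : Fin m × Fin n, centreDist v - 1 ≤ maxWalkLength m n := by
  rw [Nat.odd_iff] at hm
  rw [Nat.even_iff] at hn
  have h0 := hasStraddlingWalk_singleton (m := m) (n := n) (x := 0) (y := -1)
    (by omega) (by omega)
  have h1 := h0.cons (x' := 0) (y' := 3) (by omega) (by omega) (by omega) (by omega)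
  have h2 := h1.zigzag (fun a b => a = 0 ∧ 0 < b ∧ b ≠ 1 ∧ b ≠ 3) (by omega) (by omega)
  have h3 := h2.zigzag (fun a b => a < 0 ∧ 0 < b) (by omega) (by omega)
  -- This vertex on a median links the two pairs of opposite quadrants.
  have h4 := h3.cons (x' := 0) (y' := -3) (by omega) (by omega) (by omega) (by omega)
  have h5 := h4.zigzag (fun a b => a < 0 ∧ b < 0) (by omega) (by omega)
  have h6 := h5.cons (x' := 0) (y' := 1) (by omega) (by omega) (by omega) (by omega)
  have := h6.le_maxWalkLength (by omega) (fun v => by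
    have := centredSnd_mod_two v
    omega)
  norm_num at this
  linarith

/-- Of the two median vertices, `(-1, 0)` links the quadrant pairs and `(1, 0)` is the start; the
ends have `centreDist` 1 and 3. -/
theorem le_maxWalkLength_two_of_odd (hn : Odd n) (hn3 : 3 ≤ n) :
    ∑ v : Fin 2 × Fin n, centreDist v - 2 ≤ maxWalkLength 2 n := by
  rw [Nat.odd_iff] at hn
  have h0 := hasStraddlingWalk_singleton (m := 2) (n := n) (x := -1) (y := 2)
    (by omega) (by omega)
  have h1 := h0.cons (x' := 1) (y' := -2) (by omega) (by omega) (by omega) (by omega)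
  have h2 := h1.zigzag (fun a b => 0 < a ∧ b < 0 ∧ b ≠ -2) (by omega) (by omega)
  have h3 := h2.cons (x' := -1) (y' := 0) (by omega) (by omega) (by omega) (by omega)
  have h4 := h3.zigzag (fun a b => a < 0 ∧ b < 0) (by omega) (by omega)
  have h5 := h4.cons (x' := 1) (y' := 0) (by omega) (by omega) (by omega) (by omega)
  have := h5.le_maxWalkLength (by omega) (fun v => by
    have := centredFst_mod_two v
    have := centredFst_bounds v
    push_cast at *
    have : centredFst v = 1 ∨ centredFst v = -1 := by omega
    omega)
  norm_num at this
  linarith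

theorem le_maxWalkLength_of_even_of_even (hm : Even m) (hn : Even n) (hm2 : 2 ≤ m) (hn3 : 3 ≤ n) :
    ∑ v : Fin m × Fin n, centreDist v - 3 ≤ maxWalkLength m n := by
  rw [Nat.even_iff] at hm hn
  have h0 := hasStraddlingWalk_singleton (m := m) (n := n) (x := -1) (y := -3)
    (by omega) (by omega)
  have h1 := h0.cons (x' := 1) (y' := 3) (by omega) (by omega) (by omega) (by omega)
  have h2 := h1.zigzag (fun a b => 0 < a ∧ 0 < b ∧ ¬ (a = 1 ∧ (b = 1 ∨ b = 3)))
    (by omega) (by omega)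
  have h3 := h2.cons (x' := -1) (y' := -1) (by omega) (by omega) (by omega) (by omega)
  have h4 := h3.cons (x' := 1) (y' := 1) (by omega) (by omega) (by omega) (by omega)
  -- The second walk covers the other pair of opposite quadrants.
  have k0 := hasStraddlingWalk_singleton (m := m) (n := n) (x := 1) (y := -1)
    (by omega) (by omega)
  have k1 := k0.cons (x' := -1) (y' := 1) (by omega) (by omega) (by omega) (by omega)
  have k2 := k1.zigzag (fun a b => a < 0 ∧ 0 < b ∧ ¬ (a = -1 ∧ (b = 1 ∨ b = 3)))
    (by omega) (by omega)
  have k3 := k2.cons (x' := 1) (y' := -3) (by omega) (by omega) (by omega) (by omega)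
  have k4 := k3.cons (x' := -1) (y' := 3) (by omega) (by omega) (by omega) (by omega)
  obtain ⟨s, t, l, hsx, hsy, htx, hty, hnd, hch, hmem⟩ := h4.exists_cons (by omega)
  obtain ⟨s', t', l', hsx', hsy', htx', hty', hnd', hch', hmem'⟩ := k4.exists_cons (by omega)
  have hnd'' : ((s :: l ++ [t]) ++ s' :: (l' ++ [t'])).Nodup := by
    refine List.nodup_append'.2 ⟨hnd, hnd', fun v hv hv' => ?_⟩
    have e1 := (hmem v).1 hv
    have e2 := (hmem' v).1 hv'
    clear hmem hmem' h0 h1 h2 h3 h4 k0 k1 k2 k3 k4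
    omega
  have hmem'' : ∀ v, v ∈ (s :: l ++ [t]) ++ s' :: (l' ++ [t']) := by
    intro v
    refine List.mem_append.2 ?_
    rw [List.cons_append, hmem, hmem']
    have := centredFst_mod_two v
    have := centredSnd_mod_two v
    omega
  have hlen := listLength_le_maxWalkLength hnd'' hmem''
  have hsum := sum_map_eq_of_nodup hnd'' hmem''
  have e1 := two_mul_listLength_of_isChain hch
  have e2 := two_mul_listLength_of_isChain hch'
  -- The joining step from `(-1, -3)` to `(-1, 3)` has doubled length 6 against 4 + 4, losing 2; the
  -- outer ends lose 2 + 2. The total 6 is halved to 3.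
  have e3 := two_mul_manhattanDist t s'
  rw [listLength_append] at hlen
  rw [List.map_append, List.sum_append] at hsum
  have ds : centreDist s = 2 := by simp [centreDist, hsx, hsy]
  have dt : centreDist t = 4 := by simp [centreDist, htx, hty]
  have ds' : centreDist s' = 4 := by simp [centreDist, hsx', hsy']
  have dt' : centreDist t' = 2 := by simp [centreDist, htx', hty']
  rw [htx, hty, hsx', hsy'] at e3
  norm_num at e3
  rw [List.cons_append] at hlen hsum
  linarith

theorem le_maxWalkLength_two_two : 5 ≤ maxWalkLength 2 2 := by
  have := listLength_le_maxWalkLength (m := 2) (n := 2) (l := [(0, 0), (1, 1), (0, 1), (1, 0)])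
    (by decide) (by decide)
  exact le_trans (by decide) this

end Constructions

/-! ### Minimal distance to the centre by parity, and the final bounds. -/

theorem one_le_centreDist_of_even_left {m n : ℕ} (hm : Even m) (v : Fin m × Fin n) :
    1 ≤ centreDist v := by
  rw [Nat.even_iff] at hm
  have := centredFst_mod_two v
  have := Int.one_le_abs (show centredFst v ≠ 0 by omega)
  have := abs_nonneg (centredSnd v)
  rw [centreDist]
  omega

theorem one_le_centreDist_of_even_right {m n : ℕ} (hn : Even n) (v : Fin m × Fin n) :
    1 ≤ centreDist v := by
  rw [Nat.even_iff] at hn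
  have := centredSnd_mod_two v
  have := Int.one_le_abs (show centredSnd v ≠ 0 by omega)
  have := abs_nonneg (centredFst v)
  rw [centreDist]
  omega

theorem two_le_centreDist {m n : ℕ} (hm : Even m) (hn : Even n) (v : Fin m × Fin n) :
    2 ≤ centreDist v := by
  rw [Nat.even_iff] at hm hn
  have := centredFst_mod_two v
  have := centredSnd_mod_two v
  have h1 := Int.one_le_abs (show centredFst v ≠ 0 by omega)
  have h2 := Int.one_le_abs (show centredSnd v ≠ 0 by omega)
  rw [centreDist]
  omega

theorem maxWalkLength_even_even {m n : ℕ} (hm : Even m) (hn : Even n) (hm2 : 2 ≤ m)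
    (hn3 : 3 ≤ n) :
    (m * n * (m + n) : ℤ) - 6 ≤ 2 * maxWalkLength m n ∧
      2 * maxWalkLength m n ≤ (m * n * (m + n) : ℤ) - 4 := by
  have h1 := le_maxWalkLength_of_even_of_even hm hn hm2 hn3
  have h2 := maxWalkLength_le (by omega) (by omega) (two_le_centreDist hm hn)
  have h3 := two_mul_sum_centreDist m n
  rw [Nat.even_iff] at hm hn
  have e1 : (m : ℤ) % 2 = 0 := by omega
  have e2 : (n : ℤ) % 2 = 0 := by omega
  rw [e1, e2] at h3
  constructor <;> linarith

theorem maxWalkLength_odd_odd {m n : ℕ} (hm : Odd m) (hn : Odd n) (hm3 : 3 ≤ m) (hn3 : 3 ≤ n) :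
    (m * n * (m + n) : ℤ) - (m + n) - 2 ≤ 2 * maxWalkLength m n ∧
      2 * maxWalkLength m n ≤ (m * n * (m + n) : ℤ) - (m + n) := by
  have h1 := le_maxWalkLength_of_odd_of_odd hm hn hm3 hn3
  have h2 := maxWalkLength_le (m := m) (n := n) (k := 0) (by omega) (by omega)
    (fun v => add_nonneg (abs_nonneg _) (abs_nonneg _))
  have h3 := two_mul_sum_centreDist m n
  rw [Nat.odd_iff] at hm hn
  have e1 : (m : ℤ) % 2 = 1 := by omega
  have e2 : (n : ℤ) % 2 = 1 := by omega
  rw [e1, e2] at h3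
  constructor <;> linarith

theorem maxWalkLength_odd_even {m n : ℕ} (hm : Odd m) (hn : Even n) (hm3 : 3 ≤ m)
    (hn3 : 3 ≤ n) : 2 * maxWalkLength m n = (m * n * (m + n) : ℤ) - n - 2 := by
  have h1 := le_maxWalkLength_of_odd_of_even hm hn hm3 hn3
  have h2 := maxWalkLength_le (by omega) (by omega) (one_le_centreDist_of_even_right (m := m) hn)
  have h3 := two_mul_sum_centreDist m n
  rw [Nat.odd_iff] at hm
  rw [Nat.even_iff] at hn
  have e1 : (m : ℤ) % 2 = 1 := by omega
  have e2 : (n : ℤ) % 2 = 0 := by omega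
  rw [e1, e2] at h3
  apply le_antisymm <;> linarith

theorem maxWalkLength_two {n : ℕ} (hn2 : 2 ≤ n) :
    ((n : ℤ) + 1) ^ 2 - 4 ≤ maxWalkLength 2 n ∧ maxWalkLength 2 n ≤ ((n : ℤ) + 1) ^ 2 - 3 := by
  have h3 := two_mul_sum_centreDist 2 n
  rcases Nat.even_or_odd n with hn | hn
  · rcases hn2.eq_or_lt with rfl | hn3
    · have h1 := le_maxWalkLength_two_two
      have h2 := maxWalkLength_le (by omega) (by omega) (two_le_centreDist hn hn)
      norm_num at h3 ⊢
      omega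
    · have h := maxWalkLength_even_even (m := 2) even_two hn le_rfl hn3
      push_cast at h
      constructor <;> linarith
  · have hn3 : 3 ≤ n := by
      rw [Nat.odd_iff] at hn
      omega
    have h1 := le_maxWalkLength_two_of_odd hn hn3
    have h2 := maxWalkLength_le (by omega) (by omega)
      (one_le_centreDist_of_even_left (n := n) even_two)
    rw [Nat.odd_iff] at hn
    have e2 : (n : ℤ) % 2 = 1 := by omega
    rw [e2] at h3
    norm_num at h3
    constructor <;> linarith

theorem theorem1 :
    (∀ m n : ℕ, 3 ≤ m → 3 ≤ n →
      (Even m → Even n →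
        (maxWalkLength m n : ℚ) ∈
          ({(m * n * (m + n) / 2 - 3 : ℚ), (m * n * (m + n) / 2 - 3 + 1 : ℚ)} : Set ℚ)) ∧
      (Odd m → Odd n →
        (maxWalkLength m n : ℚ) ∈
          ({(m * n * (m + n) / 2 - (m + n) / 2 - 1 : ℚ),
            (m * n * (m + n) / 2 - (m + n) / 2 - 1 + 1 : ℚ)} : Set ℚ)) ∧
      (Odd m → Even n →
        (maxWalkLength m n : ℚ) = (m * n * (m + n) / 2 - n / 2 - 1 : ℚ))) ∧
    (∀ n : ℕ, 2 ≤ n →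
      maxWalkLength 2 n ∈ ({((n : ℤ) + 1) ^ 2 - 4, ((n : ℤ) + 1) ^ 2 - 4 + 1} : Set ℤ)) ∧
    (∀ n : ℕ, 2 ≤ n →
      (Even n → maxWalkLength n n ∈ ({(n : ℤ) ^ 3 - 3, (n : ℤ) ^ 3 - 3 + 1} : Set ℤ)) ∧
      (Odd n → maxWalkLength n n ∈ ({(n : ℤ) ^ 3 - n - 1, (n : ℤ) ^ 3 - n - 1 + 1} : Set ℤ))) := by
  refine ⟨fun m n hm3 hn3 => ⟨fun hm hn => ?_, fun hm hn => ?_, fun hm hn => ?_⟩,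
    fun n hn2 => ?_, fun n hn2 => ⟨fun hn => ?_, fun hn => ?_⟩⟩
  · have h := maxWalkLength_even_even hm hn (by omega) hn3
    -- Evenness makes the rational endpoints integers, so the bounds leave exactly two values.
    have hr : Even ((m * n * (m + n) : ℤ)) := by
      simp [hm]
    obtain ⟨r, hr⟩ := hr
    have hrq : (m * n * (m + n) : ℚ) = r + r := by exact_mod_cast hr
    have h' : maxWalkLength m n = r - 3 ∨ maxWalkLength m n = r - 2 := by omega
    rw [hrq]
    rcases h' with h' | h' <;> rw [h'] <;> push_cast
    · exact .inl (by ring)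
    · exact .inr (by simp; ring)
  · have h := maxWalkLength_odd_odd hm hn hm3 hn3
    obtain ⟨r, hr⟩ : Even ((m + n : ℤ)) := by
      exact_mod_cast hm.add_odd hn
    have hs : (m * n * (m + n) : ℤ) = 2 * (m * n * r) := by rw [hr]; ring
    have hrq : (m + n : ℚ) = r + r := by exact_mod_cast hr
    have h' : maxWalkLength m n = m * n * r - r - 1 ∨ maxWalkLength m n = m * n * r - r := by
      omega
    rw [hrq]
    rcases h' with h' | h' <;> rw [h'] <;> push_cast
    · exact .inl (by ring)
    · exact .inr (by simp; ring)
  · have h := maxWalkLength_odd_even hm hn hm3 hn3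
    have hq : (2 * maxWalkLength m n : ℚ) = m * n * (m + n) - n - 2 := by exact_mod_cast h
    linarith
  · have h := maxWalkLength_two hn2
    simp only [Set.mem_insert_iff, Set.mem_singleton_iff]
    omega
  · have h : (n : ℤ) ^ 3 - 3 ≤ maxWalkLength n n ∧ maxWalkLength n n ≤ (n : ℤ) ^ 3 - 2 := by
      rcases hn2.eq_or_lt with rfl | hn3
      · have := maxWalkLength_two le_rfl
        norm_num at this ⊢
        omega
      · have h := maxWalkLength_even_even hn hn hn2 hn3
        constructor <;> linarith
    simp only [Set.mem_insert_iff, Set.mem_singleton_iff]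
    omega
  · have hn3 : 3 ≤ n := by
      rw [Nat.odd_iff] at hn
      omega
    have h := maxWalkLength_odd_odd hn hn hn3 hn3
    have h' : (n * n * (n + n) : ℤ) = 2 * (n : ℤ) ^ 3 := by ring
    simp only [Set.mem_insert_iff, Set.mem_singleton_iff]
    omega
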